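/- Let $G$ be a connected Lie subgroup of $\mathrm{GL}(n,\mathbb{R})$, in the weak sense of an immersed (not necessarily embedded) subgroup: $G$ is a connected real Lie group together with an injective smooth group homomorphism $\iota\colon G\to \mathrm{GL}(n,\mathbb{R})$ that is an immersion. Assume that $G$ acts irreducibly on $\mathbb{R}^n$ (that is, $\mathbb{R}^n\neq 0$ and its only $G$-invariant linear subspaces are $0$ and $\mathbb{R}^n$). Let $Z(G)$ be the center of $G$ and $Z(G)_0$ the identity component of $Z(G)$, both with the topology and Lie group structure induced from $G$, and assume that $Z(G)_0$ is non-trivial. Then (a) $Z(G)_0$ (that is, its image under $\iota$) is equal to $\mathbb{R}^+\cdot \mathrm{Id}=\{r\,\mathrm{Id}\mid r>0\}$, or (b) $Z(G)_0$ is isomorphic, as a Lie group, to $\mathbb{C}^*$ $(=\mathbb{R}^+\times S^1)$, or (c) $Z(G)_0$ is isomorphic, as a Lie group, to a one-parameter subgroup of $\mathbb{C}^*$, i.e. to the image of a smooth homomorphism $\mathbb{R}\to\mathbb{C}^*$. Apart from case (a), cases (b) and (c) occur only if $n$ is even; that is, if (a) does not hold, then $n$ is even and (b) or (c) holds. -/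

import Mathlib

open scoped Manifold ContDiff

/-- The algebra of endomorphisms of `ℝⁿ`. -/
abbrev RealEnd (n : ℕ) : Type := EuclideanSpace ℝ (Fin n) →L[ℝ] EuclideanSpace ℝ (Fin n)

/-- `GL(n, ℝ)`, as the Lie group of units of the algebra of endomorphisms of `ℝⁿ`. -/
abbrev RealGL (n : ℕ) : Type := (RealEnd n)ˣ

/-- The identity component `Z(G)_0` of the center of a Lie group `G` (modelled on `E`), as a
subgroup of `G`. The center carries the subspace topology of `G`. -/
def centerIdentityComponent (E : Type*) [NormedAddCommGroup E] [NormedSpace ℝ E]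
    (G : Type*) [Group G] [TopologicalSpace G] [ChartedSpace E G] [LieGroup 𝓘(ℝ, E) ∞ G] :
    Subgroup G :=
  haveI : IsTopologicalGroup G := topologicalGroup_of_lieGroup 𝓘(ℝ, E) ∞
  (Subgroup.connectedComponentOfOne (Subgroup.center G)).map (Subgroup.center G).subtype

/-- The linear action on `ℝⁿ` of a group mapped to `GL(n, ℝ)`. -/
def linearAction {n : ℕ} {G : Type*} [Group G] (ι : G →* RealGL n) :
    Representation ℝ G (EuclideanSpace ℝ (Fin n)) where
  toFun g := ((ι g : RealEnd n) : EuclideanSpace ℝ (Fin n) →ₗ[ℝ] EuclideanSpace ℝ (Fin n))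
  map_one' := by ext; simp
  map_mul' g h := by ext; simp

/-- Smoothness of a map from an arbitrary subset `S` of the manifold `M` to the manifold `N`:
locally it extends to a smooth map on an open subset of `M`. If `S` is an embedded submanifold,
this is smoothness for the submanifold structure. -/
def SmoothOnSubset {E F M N : Type*} [NormedAddCommGroup E] [NormedSpace ℝ E]
    [NormedAddCommGroup F] [NormedSpace ℝ F]
    [TopologicalSpace M] [ChartedSpace E M] [TopologicalSpace N] [ChartedSpace F N]
    (S : Set M) (f : S → N) : Prop :=
  ∀ p : S, ∃ U : Set M, IsOpen U ∧ (p : M) ∈ U ∧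
    ∃ φ : M → N, ContMDiffOn 𝓘(ℝ, E) 𝓘(ℝ, F) ∞ φ U ∧ ∀ q : S, (q : M) ∈ U → φ q = f q

/-- Isomorphism of Lie groups between closed (hence embedded) subgroups `P`, `Q` of two Lie groups:
a group isomorphism that is smooth in both directions. -/
def LieIsomorphic {E F A B : Type*} [NormedAddCommGroup E] [NormedSpace ℝ E]
    [NormedAddCommGroup F] [NormedSpace ℝ F]
    [Group A] [TopologicalSpace A] [ChartedSpace E A]
    [Group B] [TopologicalSpace B] [ChartedSpace F B]
    (P : Subgroup A) (Q : Subgroup B) : Prop :=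
  ∃ e : P ≃* Q,
    SmoothOnSubset (E := E) (F := F) (P : Set A) (fun p => (e p : B)) ∧
    SmoothOnSubset (E := F) (F := E) (Q : Set B) (fun q => (e.symm q : A))

/-- One-parameter subgroups of a Lie group: images of smooth homomorphisms from `(ℝ, +)`. -/
def IsOneParameterSubgroup {E A : Type*} [NormedAddCommGroup E] [NormedSpace ℝ E]
    [Group A] [TopologicalSpace A] [ChartedSpace E A] (P : Subgroup A) : Prop :=
  ∃ γ : Multiplicative ℝ →* A,
    ContMDiff 𝓘(ℝ, ℝ) 𝓘(ℝ, E) ∞ (fun t : ℝ => γ (Multiplicative.ofAdd t)) ∧ P = γ.range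

/-! ### Connected locally compact groups injected into `ℂˣ` -/

section OneParameter

open Filter Topology

/-! By Schur's lemma every nonzero endomorphism commuting with `G` is injective. Hence the real
algebra `K` generated by the image of the center is a finite-dimensional commutative domain, that
is, `ℝ` or `ℂ` (`exists_subalgebra_center`). If `K` is `ℝ`, then `Z(G)_0` is a nontrivial connected
group of scalars, and connectedness forces all positive ones. If `K` is `ℂ`, the image of `i` is a
complex structure, so `n` is even, and `Z(G)_0` injects continuously into `ℂˣ`.

The topology of `Z(G)_0` comes from `G` and could a priori be finer than that of its image. The
closed subgroup argument still works for a connected locally compact group `A` injected into `ℂˣ`: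
the directions `X` for which `exp (t X)` lifts to elements near `1` form a real subspace `L` of `ℂ`,
and the image of `A` is `exp L` (`map_eq_exp_of_connected`). The dimension of `L` separates `ℂˣ`
from one-parameter subgroups. No real subspace of `ℂ` winds densely under `exp`, so the injection is
an embedding (`exists_nhds_one_of_map_mem`). Smoothness of the inverse then comes from local left
inverses of the immersion `ι` (`lieIsomorphic_range`). -/

/-- The directions `X` such that `exp (t X)`, for small `t`, is the image of an element of `A`
close to `1`. -/
def liftableDirections {A : Type*} [Group A] [TopologicalSpace A] [IsTopologicalGroup A]
    (j : A →* ℂˣ) : Submodule ℝ ℂ where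
  carrier := {X | ∀ U ∈ 𝓝 (1 : A), ∃ ε > 0, ∀ t : ℝ, |t| < ε →
    ∃ a ∈ U, (j a : ℂ) = Complex.exp (t • X)}
  zero_mem' U hU := ⟨1, one_pos, fun t _ => ⟨1, mem_of_mem_nhds hU, by simp⟩⟩
  add_mem' {X Y} hX hY U hU := by
    obtain ⟨V, hV, hVU⟩ := exists_nhds_one_split hU
    obtain ⟨ε, hε, h⟩ := hX V hV
    obtain ⟨δ, hδ, h'⟩ := hY V hV
    refine ⟨min ε δ, lt_min hε hδ, fun t ht => ?_⟩
    obtain ⟨a, ha, hja⟩ := h t (ht.trans_le (min_le_left _ _))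
    obtain ⟨b, hb, hjb⟩ := h' t (ht.trans_le (min_le_right _ _))
    exact ⟨a * b, hVU a ha b hb, by rw [map_mul, Units.val_mul, hja, hjb, smul_add, Complex.exp_add]⟩
  smul_mem' c X hX U hU := by
    obtain ⟨ε, hε, h⟩ := hX U hU
    refine ⟨ε / (|c| + 1), by positivity, fun t ht => ?_⟩
    obtain ⟨a, ha, hja⟩ := h (t * c) (by
      rw [lt_div_iff₀ (by positivity)] at ht
      rw [abs_mul]
      nlinarith [abs_nonneg t, abs_nonneg c])
    exact ⟨a, ha, by rw [hja, mul_smul]⟩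

variable {A : Type*} [Group A] [TopologicalSpace A] {j : A →* ℂˣ}

/-- Powers of small elements converge to exponentials. -/
lemma map_limit_pow_eq_exp (hj : Continuous j) {β : Type*} {l : Filter β} [l.NeBot] {h : β → A}
    {x : β → ℂ} (hx0 : ∀ᶠ b in l, x b ≠ 0) (hhx : ∀ᶠ b in l, (j (h b) : ℂ) = Complex.exp (x b))
    {X : ℂ} (hX : Tendsto (fun b => ‖x b‖⁻¹ • x b) l (𝓝 X)) {k : β → ℕ} {s : ℝ}
    (hs : Tendsto (fun b => k b * ‖x b‖) l (𝓝 s)) {w : A}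
    (hw : Tendsto (fun b => h b ^ k b) l (𝓝 w)) : (j w : ℂ) = Complex.exp (s • X) := by
  have h1 : Tendsto (fun b => (j (h b ^ k b) : ℂ)) l (𝓝 (j w)) :=
    ((Units.continuous_val.comp hj).tendsto w).comp hw
  have h2 := (Complex.continuous_exp.tendsto (s • X)).comp (hs.smul hX)
  refine tendsto_nhds_unique h1 (h2.congr' ?_)
  filter_upwards [hx0, hhx] with b hb hb'
  have : ‖x b‖ ≠ 0 := norm_ne_zero_iff.2 hb
  simp only [Function.comp_apply, map_pow, Units.val_pow_eq_pow_val, hb', ← Complex.exp_nat_mul,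
    smul_smul, mul_assoc, mul_inv_cancel₀ this]
  simp

variable [IsTopologicalGroup A]

/-- Limits of normalised logarithms of elements tending to `1` are liftable directions. -/
lemma mem_liftableDirections_of_tendsto [LocallyCompactSpace A] (hj : Continuous j)
    (hinj : Function.Injective j) {β : Type*} {l : Ultrafilter β} {h : β → A} {x : β → ℂ}
    (hx0 : ∀ᶠ b in l, x b ≠ 0) (hhx : ∀ᶠ b in l, (j (h b) : ℂ) = Complex.exp (x b))
    (hh : Tendsto h l (𝓝 1)) (hx : Tendsto x l (𝓝 0))
    {X : ℂ} (hX : Tendsto (fun b => ‖x b‖⁻¹ • x b) l (𝓝 X)) : X ∈ liftableDirections j := by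
  have main : ∀ U ∈ 𝓝 (1 : A), ∃ ε > 0, ∀ t : ℝ, 0 ≤ t → t < ε →
      ∃ a ∈ U, (j a : ℂ) = Complex.exp (t • X) := by
    intro U hU
    obtain ⟨W, hW, hWU, hWc⟩ := local_compact_nhds hU
    have hjc : Continuous fun a => (j a : ℂ) := Units.continuous_val.comp hj
    have hK : IsClosed ((fun a => (j a : ℂ)) '' (W \ interior W)) :=
      ((hWc.diff isOpen_interior).image hjc).isClosed
    have hcont : Continuous fun s : ℝ => Complex.exp (s • X) := by fun_prop
    have h0 : (0 : ℝ) ∈ (fun s : ℝ => Complex.exp (s • X)) ⁻¹'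
        ((fun a => (j a : ℂ)) '' (W \ interior W))ᶜ := by
      rintro ⟨a, ha, hja⟩
      have : a = 1 := hinj (Units.ext (by simpa using hja))
      exact ha.2 (this ▸ mem_interior_iff_mem_nhds.2 hW)
    -- For `|s| < ε`, `exp (s X)` is not the image of a point of `W \ interior W`. This will prevent
    -- the powers of `h b` from leaving `W` too early.
    obtain ⟨ε, hε, hball⟩ := Metric.isOpen_iff.1 (hK.isOpen_compl.preimage hcont) 0 h0
    refine ⟨ε, hε, fun t ht0 htε => ?_⟩
    have hnx : Tendsto (fun b => ‖x b‖) l (𝓝 0) := by simpa using hx.norm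
    have hm : ∀ᶠ b in l, (⌊t / ‖x b‖⌋₊ : ℝ) * ‖x b‖ ≤ t := by
      filter_upwards [hx0] with b hb
      have : 0 < ‖x b‖ := norm_pos_iff.2 hb
      exact (le_div_iff₀ this).1 (Nat.floor_le (by positivity))
    -- Since `l` is an ultrafilter, either almost all sequences of powers stay in `W` up to time
    -- `t`, and their endpoints converge to the desired lift, or almost all leave it.
    rcases l.em (fun b => ∀ k ≤ ⌊t / ‖x b‖⌋₊, h b ^ k ∈ W) with hN | hN
    · obtain ⟨w, hwW, hw⟩ := hWc.ultrafilter_le_nhds (l.map fun b => h b ^ ⌊t / ‖x b‖⌋₊)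
        (le_principal_iff.2 (hN.mono fun b hb => hb _ le_rfl))
      refine ⟨w, hWU hwW, map_limit_pow_eq_exp hj hx0 hhx hX ?_ hw⟩
      have hlow : Tendsto (fun b => t - ‖x b‖) l (𝓝 t) := by simpa using hnx.const_sub t
      refine tendsto_of_tendsto_of_tendsto_of_le_of_le' hlow tendsto_const_nhds ?_ hm
      filter_upwards [hx0] with b hb
      have hpos : 0 < ‖x b‖ := norm_pos_iff.2 hb
      have := (div_lt_iff₀ hpos).1 (Nat.lt_floor_add_one (t / ‖x b‖))
      linarith
    · exfalso
      -- `k` is the last index before the first exit from `W`. As `h b` tends to `1`, the powers `k`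
      -- and `k + 1` have the same limit, which lies in `W` but not in its interior.
      have hex : ∀ᶠ b in l, ∃ k, k + 1 ≤ ⌊t / ‖x b‖⌋₊ ∧ h b ^ k ∈ W ∧ h b ^ (k + 1) ∉ W := by
        filter_upwards [hN] with b hb
        classical
        push Not at hb
        have hb' : ∃ k, h b ^ k ∉ W := let ⟨k, _, hk⟩ := hb; ⟨k, hk⟩
        obtain ⟨k, hkm, hk⟩ := hb
        have hpos : Nat.find hb' ≠ 0 := by
          intro h0
          have := Nat.find_spec hb'
          rw [h0, pow_zero] at this
          exact this (mem_of_mem_nhds hW)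
        obtain ⟨r, hr⟩ := Nat.exists_eq_succ_of_ne_zero hpos
        refine ⟨r, ?_, ?_, ?_⟩
        · exact hr.symm.le.trans ((Nat.find_min' hb' hk).trans hkm)
        · exact not_not.1 (Nat.find_min hb' (hr ▸ Nat.lt_succ_self r))
        · exact (congrArg (fun i => h b ^ i ∉ W) hr).mp (Nat.find_spec hb')
      obtain ⟨k, hk⟩ := hex.choice
      have hkt : ∀ᶠ b in l, (k b : ℝ) * ‖x b‖ ∈ Set.Icc 0 t := by
        filter_upwards [hk, hm] with b hb hb'
        refine ⟨by positivity, le_trans ?_ hb'⟩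
        gcongr
        exact_mod_cast (Nat.le_succ _).trans hb.1
      obtain ⟨s, hsI, hs⟩ := isCompact_Icc.ultrafilter_le_nhds (l.map fun b => (k b : ℝ) * ‖x b‖)
        (le_principal_iff.2 hkt)
      obtain ⟨w, hwW, hw⟩ := hWc.ultrafilter_le_nhds (l.map fun b => h b ^ k b)
        (le_principal_iff.2 (hk.mono fun b hb => hb.2.1))
      have hjw := map_limit_pow_eq_exp hj hx0 hhx hX hs hw
      have hw' : Tendsto (fun b => h b ^ (k b + 1)) l (𝓝 w) := by
        have : Tendsto (fun b => h b ^ k b * h b) l (𝓝 (w * 1)) := Tendsto.mul hw hh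
        simpa [pow_succ] using this
      have hwi : w ∉ interior W := by
        intro hwi
        have h1 : ∀ᶠ b in (l : Filter β), h b ^ (k b + 1) ∈ W :=
          hw'.eventually (mem_interior_iff_mem_nhds.1 hwi)
        obtain ⟨b, hb, hb'⟩ := (h1.and hk).exists
        exact hb'.2.2 hb
      have hsε : s ∈ Metric.ball (0 : ℝ) ε := by
        rw [Metric.mem_ball, Real.dist_eq, sub_zero, abs_of_nonneg hsI.1]
        exact hsI.2.trans_lt htε
      exact hball hsε ⟨w, ⟨hwW, hwi⟩, hjw⟩
  intro U hU
  -- Negative times are reached by inverses, hence the symmetric neighbourhood.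
  obtain ⟨ε, hε, h1⟩ := main (U ∩ U⁻¹) (inter_mem hU (inv_mem_nhds_one A hU))
  refine ⟨ε, hε, fun t ht => ?_⟩
  obtain ⟨a, ha, hja⟩ := h1 |t| (abs_nonneg t) ht
  rcases abs_cases t with ⟨h2, -⟩ | ⟨h2, -⟩
  · exact ⟨a, ha.1, by rw [hja, h2]⟩
  · exact ⟨a⁻¹, ha.2, by
      rw [map_inv, Units.val_inv_eq_inv_val, hja, h2, neg_smul, Complex.exp_neg, inv_inv]⟩

lemma exists_lift_sum_of_mem_liftableDirections {κ : Type*} (s : Finset κ) (v : κ → ℂ)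
    (hv : ∀ i, v i ∈ liftableDirections j) : ∀ U ∈ 𝓝 (1 : A), ∃ ε > 0, ∀ t : κ → ℝ,
    (∀ i, |t i| < ε) → ∃ a ∈ U, (j a : ℂ) = Complex.exp (∑ i ∈ s, t i • v i) := by
  classical
  induction s using Finset.induction_on with
  | empty => exact fun U hU => ⟨1, one_pos, fun t _ => ⟨1, mem_of_mem_nhds hU, by simp⟩⟩
  | insert i s hi ih =>
    intro U hU
    obtain ⟨V, hV, hVU⟩ := exists_nhds_one_split hU
    obtain ⟨ε, hε, h⟩ := hv i V hV
    obtain ⟨δ, hδ, h'⟩ := ih V hV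
    refine ⟨min ε δ, lt_min hε hδ, fun t ht => ?_⟩
    obtain ⟨a, ha, hja⟩ := h (t i) ((ht i).trans_le (min_le_left _ _))
    obtain ⟨b, hb, hjb⟩ := h' t fun k => (ht k).trans_le (min_le_right _ _)
    exact ⟨a * b, hVU a ha b hb, by
      rw [map_mul, Units.val_mul, hja, hjb, Finset.sum_insert hi, Complex.exp_add]⟩

/-- The `ε` in `liftableDirections` depends on the direction. Coordinates in a finite basis are
small when `X` is, so one `δ` serves the whole subspace. -/
lemma exists_lift_of_norm_lt {U : Set A} (hU : U ∈ 𝓝 (1 : A)) : ∃ δ > 0,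
    ∀ X ∈ liftableDirections j, ‖X‖ < δ → ∃ a ∈ U, (j a : ℂ) = Complex.exp X := by
  let b := Module.finBasis ℝ (liftableDirections j)
  obtain ⟨ε, hε, h⟩ := exists_lift_sum_of_mem_liftableDirections Finset.univ
    (fun i => (b i : ℂ)) (fun i => (b i).2) U hU
  let f : liftableDirections j →ₗ[ℝ] (Fin _ → ℝ) := b.equivFun.toLinearMap
  have hf : Continuous f := f.continuous_of_finiteDimensional
  obtain ⟨δ, hδ, hball⟩ := Metric.continuousAt_iff.1 (hf.continuousAt (x := 0)) ε hε
  refine ⟨δ, hδ, fun X hX hXδ => ?_⟩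
  have h1 : dist (f ⟨X, hX⟩) (f 0) < ε := hball (by simpa using hXδ)
  rw [map_zero, dist_zero_right, pi_norm_lt_iff hε] at h1
  obtain ⟨a, ha, hja⟩ := h (f ⟨X, hX⟩) h1
  refine ⟨a, ha, hja.trans ?_⟩
  have h2 := congrArg (liftableDirections j).subtype (b.sum_equivFun ⟨X, hX⟩)
  rw [map_sum] at h2
  exact congrArg Complex.exp h2

/-- The elements mapped to the exponential of a liftable direction form a neighbourhood of `1`. -/
lemma eventually_map_eq_exp [LocallyCompactSpace A] (hj : Continuous j)
    (hinj : Function.Injective j) :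
    ∀ᶠ a in 𝓝 (1 : A), ∃ X ∈ liftableDirections j, (j a : ℂ) = Complex.exp X := by
  by_contra hcon
  set L := liftableDirections j with hL
  obtain ⟨l, hl⟩ := Filter.exists_ultrafilter_iff.2
    (Filter.frequently_iff_neBot.1 (Filter.not_eventually.1 hcon))
  have hl1 : (l : Filter A) ≤ 𝓝 1 := hl.trans inf_le_left
  have hl2 : ∀ᶠ a in l, ¬ ∃ X ∈ L, (j a : ℂ) = Complex.exp X :=
    le_principal_iff.1 (hl.trans inf_le_right)
  let y : A → ℂ := fun a => Complex.log (j a)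
  have hy : Tendsto y l (𝓝 0) := by
    have : ContinuousAt y 1 := ContinuousAt.clog (Units.continuous_val.comp hj).continuousAt (by simp)
    have h := this.tendsto.mono_left hl1
    simpa [y] using h
  -- Split the logarithm along `L` and its orthogonal complement. Dividing `a` by a lift of `exp (p
  -- a)` leaves an element over `exp (q a)`, whose limiting direction is a unit vector in both `L`
  -- and `Lᗮ`.
  let p : A → ℂ := fun a => L.starProjection (y a)
  let q : A → ℂ := fun a => y a - p a
  have hpL : ∀ a, p a ∈ L := fun a => Submodule.starProjection_apply_mem _ _
  have hqL : ∀ a, q a ∈ Lᗮ := fun a => Submodule.sub_starProjection_mem_orthogonal _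
  have hp : Tendsto p l (𝓝 0) := by
    have h := (L.starProjection.continuous.tendsto 0).comp hy
    rwa [map_zero] at h
  have hq : Tendsto q l (𝓝 0) := by simpa using hy.sub hp
  have hlift : ∀ U ∈ 𝓝 (1 : A), ∀ᶠ a in l, ∃ b ∈ U, (j b : ℂ) = Complex.exp (p a) := by
    intro U hU
    obtain ⟨δ, hδ, h⟩ := exists_lift_of_norm_lt (j := j) hU
    filter_upwards [hp.eventually (Metric.ball_mem_nhds 0 hδ)] with a ha
    exact h _ (hpL a) (by simpa using ha)
  obtain ⟨g, hg⟩ := ((hlift Set.univ univ_mem).mono fun a ⟨b, _, hb⟩ => ⟨b, hb⟩).choice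
  -- Lifts are unique because `j` is injective, so the chosen lift agrees with the ones found in
  -- arbitrarily small neighbourhoods.
  have hg1 : Tendsto g l (𝓝 1) := by
    refine fun U hU => mem_map.2 ?_
    filter_upwards [hlift U hU, hg] with a ⟨b, hb, hjb⟩ hga
    have : b = g a := hinj (Units.ext (hjb.trans hga.symm))
    exact (this ▸ hb : g a ∈ U)
  have hq0 : ∀ᶠ a in l, q a ≠ 0 := by
    filter_upwards [hl2] with a ha h0
    refine ha ⟨p a, hpL a, ?_⟩
    rw [← sub_eq_zero.1 h0, Complex.exp_log (Units.ne_zero _)]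
  have hsph : ∀ᶠ a in l, ‖q a‖⁻¹ • q a ∈ Metric.sphere (0 : ℂ) 1 := by
    filter_upwards [hq0] with a ha
    simp [inv_mul_cancel₀ (norm_ne_zero_iff.2 ha)]
  obtain ⟨X, hXs, hX⟩ := (isCompact_sphere (0 : ℂ) 1).ultrafilter_le_nhds
    (l.map fun a => ‖q a‖⁻¹ • q a) (le_principal_iff.2 hsph)
  have hXL : X ∈ L := by
    refine mem_liftableDirections_of_tendsto hj hinj (l := l) (h := fun a => (g a)⁻¹ * a) (x := q)
      hq0 ?_ ?_ hq hX
    · filter_upwards [hg] with a ha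
      rw [map_mul, map_inv, Units.val_mul, Units.val_inv_eq_inv_val, ha, ← Complex.exp_neg,
        ← Complex.exp_log (Units.ne_zero (j a)), ← Complex.exp_add]
      congr 1
      simp only [q, y]
      ring
    · simpa using hg1.inv.mul (tendsto_id.mono_left hl1 : Tendsto (fun a : A => a) l (𝓝 1))
  have hXo : X ∈ Lᗮ := (Submodule.isClosed_orthogonal L).mem_of_tendsto
    (b := (l : Filter A)) hX (Eventually.of_forall fun a => Submodule.smul_mem _ _ (hqL a))
  have hX0 : X = 0 := by
    have := Submodule.inner_right_of_mem_orthogonal hXL hXo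
    exact inner_self_eq_zero.1 this
  simp [hX0] at hXs

lemma exp_liftableDirections_mem_range {X : ℂ} (hX : X ∈ liftableDirections j) :
    ∃ a, (j a : ℂ) = Complex.exp X := by
  obtain ⟨ε, hε, h⟩ := hX Set.univ univ_mem
  obtain ⟨m, hm⟩ := exists_nat_one_div_lt hε
  obtain ⟨a, -, ha⟩ := h (1 / ((m : ℝ) + 1)) (by rwa [abs_of_pos (by positivity)])
  refine ⟨a ^ (m + 1), ?_⟩
  rw [map_pow, Units.val_pow_eq_pow_val, ha, ← Complex.exp_nat_mul]
  congr 1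
  have : (m : ℂ) + 1 ≠ 0 := by exact_mod_cast m.succ_ne_zero
  simp only [Complex.real_smul]
  push_cast
  field_simp

/-- Such elements form a subgroup containing a neighbourhood of `1`; it is open, hence closed, hence
everything. -/
lemma map_eq_exp_of_connected [LocallyCompactSpace A] [ConnectedSpace A] (hj : Continuous j)
    (hinj : Function.Injective j) (a : A) :
    ∃ X ∈ liftableDirections j, (j a : ℂ) = Complex.exp X := by
  let S : Subgroup A :=
    { carrier := {a | ∃ X ∈ liftableDirections j, (j a : ℂ) = Complex.exp X}
      one_mem' := ⟨0, zero_mem _, by simp⟩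
      mul_mem' := by
        rintro a b ⟨X, hX, ha⟩ ⟨Y, hY, hb⟩
        exact ⟨X + Y, add_mem hX hY, by rw [map_mul, Units.val_mul, ha, hb, Complex.exp_add]⟩
      inv_mem' := by
        rintro a ⟨X, hX, ha⟩
        exact ⟨-X, neg_mem hX, by
          rw [map_inv, Units.val_inv_eq_inv_val, ha, Complex.exp_neg]⟩ }
  have hopen : IsOpen (S : Set A) := S.isOpen_of_mem_nhds (eventually_map_eq_exp hj hinj)
  have : (S : Set A) = Set.univ :=
    IsClopen.eq_univ ⟨S.isClosed_of_isOpen hopen, hopen⟩ ⟨1, S.one_mem⟩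
  exact (this ▸ Set.mem_univ a : a ∈ (S : Set A))

/-- A real subspace of `ℂ` maps onto a locally closed subgroup under the exponential. -/
lemma exists_small_log_mem (L : Submodule ℝ ℂ) {δ : ℝ} (hδ : 0 < δ) : ∃ V ∈ 𝓝 (1 : ℂ),
    ∀ X ∈ L, Complex.exp X ∈ V → ∃ Y ∈ L, ‖Y‖ < δ ∧ Complex.exp Y = Complex.exp X := by
  by_cases hI : Complex.I ∈ L
  · have hc : ContinuousAt Complex.log 1 := continuousAt_clog (by simp)
    refine ⟨Complex.log ⁻¹' Metric.ball 0 δ, hc.preimage_mem_nhds ?_, fun X hX hXV => ?_⟩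
    · simpa using Metric.ball_mem_nhds (0 : ℂ) hδ
    · have he : Complex.exp (Complex.log (Complex.exp X)) = Complex.exp X :=
        Complex.exp_log (Complex.exp_ne_zero X)
      refine ⟨_, ?_, by simpa using hXV, he⟩
      -- The principal logarithm differs from `X` by a multiple of `2πi`, which lies in `L`.
      obtain ⟨m, hm⟩ := Complex.exp_eq_exp_iff_exists_int.1 he
      rw [hm]
      have : (m : ℂ) * (2 * Real.pi * Complex.I) = ((m : ℝ) * (2 * Real.pi)) • Complex.I := by
        simp [mul_assoc]
      rw [this]
      exact L.add_mem hX (L.smul_mem _ hI)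
  -- When `L` is not vertical, the real part is injective on `L`, so `‖X‖ ≤ C |Re X|` and the
  -- modulus of `exp X` alone controls `X`.
  · let f : L →ₗ[ℝ] ℝ := Complex.reLm ∘ₗ L.subtype
    have hf : LinearMap.ker f = ⊥ := by
      rw [LinearMap.ker_eq_bot']
      intro X hX
      have hre : (X : ℂ).re = 0 := hX
      have hXI : (X : ℂ) = (X : ℂ).im • Complex.I := by
        apply Complex.ext <;> simp [hre]
      by_cases him : (X : ℂ).im = 0
      · exact Subtype.ext (by rw [hXI, him]; simp)
      · refine absurd ?_ hI
        have h1 := L.smul_mem (X : ℂ).im⁻¹ X.2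
        rw [hXI, smul_smul] at h1
        simpa [inv_mul_cancel₀ him] using h1
    obtain ⟨C, hC, hfC⟩ := f.exists_antilipschitzWith hf
    have hc : ContinuousAt (fun z : ℂ => Real.log ‖z‖) 1 :=
      continuous_norm.continuousAt.log (by simp)
    refine ⟨(fun z : ℂ => Real.log ‖z‖) ⁻¹' Metric.ball 0 (δ / C), hc.preimage_mem_nhds ?_,
      fun X hX hXV => ⟨X, hX, ?_, rfl⟩⟩
    · have : (0 : ℝ) < δ / C := by have : (0 : ℝ) < C := hC; positivity
      simpa using Metric.ball_mem_nhds (0 : ℝ) this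
    · have h1 := hfC.le_mul_dist ⟨X, hX⟩ 0
      have h2 : |X.re| < δ / C := by simpa [Complex.norm_exp] using hXV
      have hC' : (0 : ℝ) < C := hC
      rw [lt_div_iff₀ hC'] at h2
      have h3 : dist (⟨X, hX⟩ : L) 0 = ‖X‖ := by simp
      have h4 : dist (f ⟨X, hX⟩) (f 0) = |X.re| := by simp [f]
      rw [h3, h4] at h1
      linarith

/-- An injective continuous homomorphism from a connected locally compact group to `ℂˣ` is an
embedding. -/
lemma exists_nhds_one_of_map_mem [LocallyCompactSpace A] [ConnectedSpace A] (hj : Continuous j)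
    (hinj : Function.Injective j) {U : Set A} (hU : U ∈ 𝓝 1) :
    ∃ V ∈ 𝓝 (1 : ℂ), ∀ a, (j a : ℂ) ∈ V → a ∈ U := by
  obtain ⟨δ, hδ, h⟩ := exists_lift_of_norm_lt (j := j) hU
  obtain ⟨V, hV, hV'⟩ := exists_small_log_mem (liftableDirections j) hδ
  refine ⟨V, hV, fun a ha => ?_⟩
  obtain ⟨X, hX, haX⟩ := map_eq_exp_of_connected hj hinj a
  obtain ⟨Y, hY, hYδ, hYX⟩ := hV' X hX (haX ▸ ha)
  obtain ⟨b, hb, hbY⟩ := h Y hY hYδ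
  have : a = b := hinj (Units.ext (by rw [haX, hbY, hYX]))
  exact this ▸ hb

lemma isOneParameterSubgroup_of_eq_exp {P : Subgroup ℂˣ} (X : ℂ)
    (hP : ∀ z : ℂˣ, z ∈ P ↔ ∃ t : ℝ, (z : ℂ) = Complex.exp (t • X)) :
    IsOneParameterSubgroup (E := ℂ) P := by
  let γ : Multiplicative ℝ →* ℂˣ := MonoidHom.toHomUnits
    { toFun := fun t => Complex.exp (t.toAdd • X)
      map_one' := by simp
      map_mul' := fun s t => by simp [add_mul, Complex.exp_add] }
  have hγ : ∀ t : ℝ, (γ (Multiplicative.ofAdd t) : ℂ) = Complex.exp (t • X) := fun t => rfl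
  refine ⟨γ, ?_, ?_⟩
  · apply ContMDiff.of_comp_isOpenEmbedding Units.isOpenEmbedding_val
    have : ContDiff ℝ ∞ fun t : ℝ => Complex.exp (t • X) := by fun_prop
    exact this.contMDiff
  · ext z
    rw [hP, MonoidHom.mem_range]
    constructor
    · rintro ⟨t, ht⟩
      exact ⟨Multiplicative.ofAdd t, Units.ext ((hγ t).trans ht.symm)⟩
    · rintro ⟨t, rfl⟩
      exact ⟨t.toAdd, hγ t.toAdd⟩

/-- The image of a connected locally compact group in `ℂˣ` is `ℂˣ` or a one-parameter subgroup. -/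
lemma range_eq_top_or_isOneParameterSubgroup [LocallyCompactSpace A] [ConnectedSpace A]
    (hj : Continuous j) (hinj : Function.Injective j) :
    j.range = ⊤ ∨ IsOneParameterSubgroup (E := ℂ) j.range := by
  have hrange : ∀ z : ℂˣ, z ∈ j.range ↔ ∃ X ∈ liftableDirections j, (z : ℂ) = Complex.exp X := by
    intro z
    constructor
    · rintro ⟨a, rfl⟩
      exact map_eq_exp_of_connected hj hinj a
    · rintro ⟨X, hX, hz⟩
      obtain ⟨a, ha⟩ := exp_liftableDirections_mem_range hX
      exact ⟨a, Units.ext (ha.trans hz.symm)⟩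
  have hle : Module.finrank ℝ (liftableDirections j) ≤ 2 :=
    (Submodule.finrank_le _).trans Complex.finrank_real_complex.le
  rcases hle.eq_or_lt with h2 | h1
  · left
    have htop : liftableDirections j = ⊤ :=
      Submodule.eq_top_of_finrank_eq (h2.trans Complex.finrank_real_complex.symm)
    refine eq_top_iff.2 fun z _ => (hrange z).2 ⟨Complex.log z, htop ▸ Submodule.mem_top, ?_⟩
    rw [Complex.exp_log (Units.ne_zero z)]
  · right
    -- Dimension zero is included: `X = 0` gives the trivial one-parameter subgroup.
    obtain ⟨X, hX⟩ := finrank_le_one_iff.1 (Nat.lt_succ_iff.1 h1)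
    refine isOneParameterSubgroup_of_eq_exp (X : ℂ) fun z => (hrange z).trans ⟨?_, ?_⟩
    · rintro ⟨Y, hY, hz⟩
      obtain ⟨c, hc⟩ := hX ⟨Y, hY⟩
      refine ⟨c, ?_⟩
      rw [hz, ← Submodule.coe_smul, hc]
    · rintro ⟨t, ht⟩
      exact ⟨_, (t • X).2, ht⟩

end OneParameter

/-! ### Immersions and smoothness of the inverse -/

section LieIsomorphism

open Filter Topology

/-- An immersion has smooth local left inverses. -/
lemma Manifold.IsImmersionAt.exists_local_left_inverse {E F M N : Type*} [NormedAddCommGroup E]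
    [NormedSpace ℝ E] [NormedAddCommGroup F] [NormedSpace ℝ F]
    [TopologicalSpace M] [ChartedSpace E M] [TopologicalSpace N] [ChartedSpace F N]
    [IsManifold 𝓘(ℝ, E) ∞ M] [IsManifold 𝓘(ℝ, F) ∞ N]
    {f : M → N} {x : M} (h : Manifold.IsImmersionAt 𝓘(ℝ, E) 𝓘(ℝ, F) ∞ f x) :
    ∃ V : Set N, IsOpen V ∧ f x ∈ V ∧ ∃ ρ : N → M, ContMDiffOn 𝓘(ℝ, F) 𝓘(ℝ, E) ∞ ρ V ∧
      ∃ W ∈ 𝓝 x, ∀ y ∈ W, ρ (f y) = y := by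
  -- In adapted charts the immersion is `u ↦ (u, 0)`, so the first component inverts it.
  let proj : F → E := fun v => (h.equiv.symm v).1
  have hproj : ContDiff ℝ ∞ proj := contDiff_fst.comp h.equiv.symm.contDiff
  have hchart : ∀ y ∈ h.domChart.source, proj (h.codChart (f y)) = h.domChart y := by
    intro y hy
    have hmem : h.domChart y ∈ (h.domChart.extend 𝓘(ℝ, E)).target := by
      simpa using h.domChart.map_source hy
    have h1 := h.writtenInCharts hmem
    simp only [Function.comp_apply, OpenPartialHomeomorph.extend_coe,
      OpenPartialHomeomorph.extend_coe_symm, modelWithCornersSelf_coe, modelWithCornersSelf_coe_symm,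
      id_eq, h.domChart.left_inv hy] at h1
    simp [proj, h1]
  refine ⟨h.codChart.source ∩ h.codChart ⁻¹' (proj ⁻¹' h.domChart.target),
    h.codChart.isOpen_inter_preimage (h.domChart.open_target.preimage hproj.continuous),
    ⟨h.mem_codChart_source, ?_⟩, fun v => h.domChart.symm (proj (h.codChart v)), ?_,
    h.domChart.source, h.domChart.open_source.mem_nhds h.mem_domChart_source, fun y hy => ?_⟩
  · rw [Set.mem_preimage, Set.mem_preimage, hchart x h.mem_domChart_source]
    exact h.domChart.map_source h.mem_domChart_source
  · have h1 := contMDiffOn_symm_of_mem_maximalAtlas (I := 𝓘(ℝ, E)) h.domChart_mem_maximalAtlas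
    have h2 := contMDiffOn_of_mem_maximalAtlas (I := 𝓘(ℝ, F)) h.codChart_mem_maximalAtlas
    exact h1.comp (hproj.contMDiff.comp_contMDiffOn (h2.mono Set.inter_subset_left))
      fun v hv => hv.2
  · exact (congrArg h.domChart.symm (hchart y hy)).trans (h.domChart.left_inv hy)

/-- A subgroup `P` of `A` is Lie isomorphic to its image under a homomorphism `j` to `B` which is
a topological embedding and is smooth on `P`, as soon as `j` followed by a smooth homomorphism `θ`
is the restriction of an immersion `f`. -/
lemma lieIsomorphic_range {E F F' A B C : Type*} [NormedAddCommGroup E] [NormedSpace ℝ E]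
    [NormedAddCommGroup F] [NormedSpace ℝ F] [NormedAddCommGroup F'] [NormedSpace ℝ F']
    [Group A] [TopologicalSpace A] [ChartedSpace E A] [LieGroup 𝓘(ℝ, E) ∞ A]
    [Group B] [TopologicalSpace B] [ChartedSpace F B] [LieGroup 𝓘(ℝ, F) ∞ B]
    [Group C] [TopologicalSpace C] [ChartedSpace F' C] [LieGroup 𝓘(ℝ, F') ∞ C]
    (f : A →* C) (hf : Manifold.IsImmersionAt 𝓘(ℝ, E) 𝓘(ℝ, F') ∞ f 1)
    (θ : B →* C) (hθ : ContMDiff 𝓘(ℝ, F) 𝓘(ℝ, F') ∞ θ)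
    (P : Subgroup A) (j : P →* B) (hinj : Function.Injective j)
    (hsmooth : SmoothOnSubset (E := E) (F := F) (P : Set A) j)
    (hemb : ∀ W ∈ 𝓝 (1 : A), ∃ V ∈ 𝓝 (1 : B), ∀ p : P, j p ∈ V → (p : A) ∈ W)
    (hcomp : ∀ p : P, θ (j p) = f p) :
    LieIsomorphic (E := E) (F := F) P j.range := by
  have : IsTopologicalGroup A := topologicalGroup_of_lieGroup 𝓘(ℝ, E) ∞
  have : IsTopologicalGroup B := topologicalGroup_of_lieGroup 𝓘(ℝ, F) ∞
  refine ⟨MonoidHom.ofInjective hinj, hsmooth, ?_⟩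
  obtain ⟨V, hV, h1V, ρ, hρ, W, hW, hρW⟩ := hf.exists_local_left_inverse
  obtain ⟨V', hV', hV'W⟩ := hemb W hW
  rintro ⟨q, a, rfl⟩
  have hτ : ContMDiff 𝓘(ℝ, F) 𝓘(ℝ, F) ∞ fun b : B => (j a)⁻¹ * b :=
    contMDiff_const.mul contMDiff_id
  -- Translated to `1`, the inverse is `ρ ∘ θ`. `V` makes `ρ` smooth, and `V'` forces the preimage
  -- into `W`, where `ρ` inverts `f`.
  let O : Set B := θ ⁻¹' V ∩ interior V'
  have hO : IsOpen O := (hV.preimage hθ.continuous).inter isOpen_interior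
  refine ⟨(fun b : B => (j a)⁻¹ * b) ⁻¹' O, hO.preimage hτ.continuous, ?_,
    fun b => (a : A) * ρ (θ ((j a)⁻¹ * b)), ?_, ?_⟩
  · refine ⟨?_, ?_⟩
    · simpa using (map_one f) ▸ h1V
    · simpa using mem_interior_iff_mem_nhds.2 hV'
  · refine contMDiffOn_const.mul (hρ.comp (hθ.comp hτ).contMDiffOn fun b hb => hb.1)
  · rintro ⟨_, p, rfl⟩ ⟨-, hp⟩
    have h1 : (a : A)⁻¹ * p ∈ W := hV'W (a⁻¹ * p) (by
      rw [map_mul, map_inv]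
      exact interior_subset hp)
    have h2 : p = (MonoidHom.ofInjective hinj).symm ⟨j p, p, rfl⟩ :=
      ((MonoidHom.ofInjective hinj).symm_apply_apply p).symm
    have h3 : θ ((j a)⁻¹ * j p) = f ((a : A)⁻¹ * p) := by
      rw [← map_inv, ← map_mul, hcomp]; rfl
    refine Eq.trans ?_ (congrArg ((↑) : P → A) h2)
    change (a : A) * ρ (θ ((j a)⁻¹ * j p)) = p
    rw [h3, hρW _ h1, mul_inv_cancel_left]

end LieIsomorphism

/-! ### Schur's lemma and the algebra generated by the center -/

section Schur

/-- A finite-dimensional real algebra that is a commutative domain is `ℝ` or `ℂ`. -/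
lemma nonempty_algEquiv_real_or_complex (K : Type*) [Ring K] [IsDomain K] [Algebra ℝ K]
    [FiniteDimensional ℝ K] (hcomm : ∀ a b : K, a * b = b * a) :
    Nonempty (K ≃ₐ[ℝ] ℝ) ∨ Nonempty (K ≃ₐ[ℝ] ℂ) := by
  let _ : CommRing K := { ‹Ring K› with mul_comm := hcomm }
  let _ : Field K := (isField_of_isIntegral_of_isField' (R := ℝ) (S := K)
    (Field.toIsField ℝ)).toField
  exact Real.nonempty_algEquiv_or K

variable {n : ℕ} {G : Type*} [Group G] {ι : G →* RealGL n}

/-- Schur's lemma. -/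
lemma injective_of_commute_irreducible (hirr : (linearAction ι).IsIrreducible) {T : RealEnd n}
    (hT : ∀ g, T * (ι g : RealEnd n) = ι g * T) (hT0 : T ≠ 0) : Function.Injective T := by
  let S : Subrepresentation (linearAction ι) :=
    { toSubmodule := LinearMap.ker (T : EuclideanSpace ℝ (Fin n) →ₗ[ℝ] EuclideanSpace ℝ (Fin n))
      apply_mem_toSubmodule := by
        intro g v hv
        have h1 : T v = 0 := hv
        have h2 := congrArg (fun L : RealEnd n => L v) (hT g)
        have h3 : T ((ι g : RealEnd n) v) = (ι g : RealEnd n) (T v) := h2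
        have h4 : T ((ι g : RealEnd n) v) = 0 := by rw [h3, h1, map_zero]
        exact h4 }
  rcases hirr.eq_bot_or_eq_top S with hS | hS
  · have : LinearMap.ker (T : EuclideanSpace ℝ (Fin n) →ₗ[ℝ] EuclideanSpace ℝ (Fin n)) = ⊥ :=
      congrArg Subrepresentation.toSubmodule hS
    exact LinearMap.ker_eq_bot.1 this
  · have : LinearMap.ker (T : EuclideanSpace ℝ (Fin n) →ₗ[ℝ] EuclideanSpace ℝ (Fin n)) = ⊤ :=
      congrArg Subrepresentation.toSubmodule hS
    refine absurd ?_ hT0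
    ext1 v
    exact (this ▸ Submodule.mem_top : v ∈ LinearMap.ker _)

lemma nontrivial_of_irreducible (hirr : (linearAction ι).IsIrreducible) :
    Nontrivial (EuclideanSpace ℝ (Fin n)) := by
  by_contra h
  rw [not_nontrivial_iff_subsingleton] at h
  obtain ⟨S, T, hST⟩ := hirr.exists_pair_ne
  refine hST (Subrepresentation.toSubmodule_injective (Subsingleton.elim _ _))

/-- The center of an irreducible linear group lies in a copy of `ℝ` or `ℂ`. -/
lemma exists_subalgebra_center (hirr : (linearAction ι).IsIrreducible) :
    ∃ K : Subalgebra ℝ (RealEnd n), (∀ z ∈ Subgroup.center G, (ι z : RealEnd n) ∈ K) ∧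
      (Nonempty (K ≃ₐ[ℝ] ℝ) ∨ Nonempty (K ≃ₐ[ℝ] ℂ)) := by
  have := nontrivial_of_irreducible hirr
  let s : Set (RealEnd n) := {T | ∃ z ∈ Subgroup.center G, T = ι z}
  have hs : ∀ T ∈ s, ∀ g, T * (ι g : RealEnd n) = ι g * T := by
    rintro _ ⟨z, hz, rfl⟩ g
    rw [← Units.val_mul, ← Units.val_mul, ← map_mul, ← map_mul, Subgroup.mem_center_iff.1 hz g]
  have hK : ∀ T ∈ Algebra.adjoin ℝ s, ∀ g, T * (ι g : RealEnd n) = ι g * T := by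
    have : Algebra.adjoin ℝ s ≤ Subalgebra.centralizer ℝ (Set.range fun g => (ι g : RealEnd n)) :=
      Algebra.adjoin_le fun T hT => by
        rw [SetLike.mem_coe, Subalgebra.mem_centralizer_iff]
        rintro _ ⟨g, rfl⟩
        exact (hs T hT g).symm
    intro T hT g
    exact ((Subalgebra.mem_centralizer_iff ℝ).1 (this hT) _ ⟨g, rfl⟩).symm
  have hcomm : ∀ a b : Algebra.adjoin ℝ s, a * b = b * a := by
    have hss : ∀ a ∈ s, ∀ b ∈ s, a * b = b * a := by
      rintro a ha _ ⟨z, hz, rfl⟩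
      exact hs a ha z
    exact fun a b => (Algebra.isMulCommutative_adjoin ℝ hss).is_comm.comm a b
  have : NoZeroDivisors (Algebra.adjoin ℝ s) := by
    refine ⟨fun {a b} hab => or_iff_not_imp_left.2 fun ha => Subtype.ext ?_⟩
    have hinj := injective_of_commute_irreducible hirr (hK a a.2) fun h => ha (Subtype.ext h)
    ext1 v
    refine hinj ?_
    have h1 : (a : RealEnd n) * b = 0 := congrArg Subtype.val hab
    have h2 := congrArg (fun L : RealEnd n => L v) h1
    exact h2.trans (map_zero _).symm
  have : IsDomain (Algebra.adjoin ℝ s) := NoZeroDivisors.to_isDomain (Algebra.adjoin ℝ s)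
  have : FiniteDimensional ℝ (Algebra.adjoin ℝ s) :=
    inferInstanceAs (FiniteDimensional ℝ (Subalgebra.toSubmodule (Algebra.adjoin ℝ s)))
  exact ⟨Algebra.adjoin ℝ s, fun z hz => Algebra.subset_adjoin ⟨z, hz, rfl⟩,
    nonempty_algEquiv_real_or_complex (Algebra.adjoin ℝ s) hcomm⟩

/-- A real vector space with a complex structure has even dimension. -/
lemma even_of_mul_self_eq_neg_one {J : RealEnd n} (hJ : J * J = -1) : Even n := by
  have h : (J : EuclideanSpace ℝ (Fin n) →ₗ[ℝ] EuclideanSpace ℝ (Fin n)) * J = (-1 : ℝ) • 1 := by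
    ext1 v
    have := congrArg (fun L : RealEnd n => L v) hJ
    simpa using this
  -- Determinants give `(det J)² = (-1)ⁿ`, impossible for odd `n`.
  have h2 := congrArg LinearMap.det h
  rw [map_mul, LinearMap.det_smul, finrank_euclideanSpace_fin, map_one, mul_one] at h2
  by_contra hn
  rw [(Nat.not_even_iff_odd.1 hn).neg_one_pow] at h2
  nlinarith [mul_self_nonneg (LinearMap.det
    (J : EuclideanSpace ℝ (Fin n) →ₗ[ℝ] EuclideanSpace ℝ (Fin n)))]

lemma even_of_subalgebra_algEquiv_complex {K : Subalgebra ℝ (RealEnd n)} (σ : K ≃ₐ[ℝ] ℂ) :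
    Even n := by
  refine even_of_mul_self_eq_neg_one (J := (σ.symm Complex.I : K)) ?_
  have : σ.symm Complex.I * σ.symm Complex.I = -1 := by
    rw [← map_mul, Complex.I_mul_I, map_neg, map_one]
  simpa using congrArg K.val this

end Schur

/-! ### Topology of the identity component of the center -/

section Center

open Filter Topology

variable {E : Type*} [NormedAddCommGroup E] [NormedSpace ℝ E]
  {G : Type*} [Group G] [TopologicalSpace G] [ChartedSpace E G] [LieGroup 𝓘(ℝ, E) ∞ G]

lemma centerIdentityComponent_le_center :
    centerIdentityComponent E G ≤ Subgroup.center G := by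
  rintro _ ⟨z, -, rfl⟩
  exact z.2

instance connectedSpace_centerIdentityComponent : ConnectedSpace (centerIdentityComponent E G) := by
  have : IsConnected (centerIdentityComponent E G : Set G) :=
    isConnected_connectedComponent.image _ continuous_subtype_val.continuousOn
  exact Subtype.connectedSpace this

/-- The center is a centralizer, closed in a Hausdorff group, and components are closed in it.
Closedness is what transmits local compactness from `G`. -/
lemma isClosed_centerIdentityComponent [T2Space G] :
    IsClosed (centerIdentityComponent E G : Set G) := by
  have : IsTopologicalGroup G := topologicalGroup_of_lieGroup 𝓘(ℝ, E) ∞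
  have hc : IsClosed (Subgroup.center G : Set G) := by
    have : (Subgroup.center G : Set G) = Set.centralizer Set.univ := by
      rw [Set.centralizer_univ]; rfl
    rw [this]
    exact Set.isClosed_centralizer _
  exact hc.isClosedEmbedding_subtypeVal.isClosedMap _ isClosed_connectedComponent

lemma locallyCompactSpace_centerIdentityComponent [T2Space G] [FiniteDimensional ℝ E] :
    LocallyCompactSpace (centerIdentityComponent E G) := by
  have : LocallyCompactSpace E := inferInstance
  have : LocallyCompactSpace G := ChartedSpace.locallyCompactSpace E G
  exact (isClosed_centerIdentityComponent (E := E)).isClosedEmbedding_subtypeVal.locallyCompactSpace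

end Center

/-- A nontrivial connected multiplicative subgroup of `ℝ` is the group of positive reals. -/
lemma range_eq_Ioi_of_connected {A : Type*} [Group A] [TopologicalSpace A] [ConnectedSpace A]
    (r : A →* ℝ) (hr : Continuous r) {a : A} (ha : r a ≠ 1) : Set.range r = Set.Ioi 0 := by
  have hord : (Set.range r).OrdConnected := (isPreconnected_range hr).ordConnected
  have hne : ∀ b, r b ≠ 0 := fun b hb => by
    have := map_mul r b b⁻¹
    simp [hb] at this
  have hpos : ∀ b, 0 < r b := fun b => by
    by_contra hb
    obtain ⟨c, hc⟩ := hord.out ⟨b, rfl⟩ ⟨1, map_one r⟩ ⟨not_lt.1 hb, zero_le_one⟩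
    exact hne c hc
  have hinv : ∀ b, r b⁻¹ = (r b)⁻¹ := fun b => eq_inv_of_mul_eq_one_left (by
    rw [← map_mul, inv_mul_cancel, map_one])
  obtain ⟨b, hb⟩ : ∃ b, 1 < r b := by
    rcases ha.lt_or_gt with h | h
    · exact ⟨a⁻¹, by rw [hinv]; exact (one_lt_inv₀ (hpos a)).2 h⟩
    · exact ⟨a, h⟩
  refine Set.Subset.antisymm (Set.range_subset_iff.2 hpos) fun y hy => ?_
  obtain ⟨k, hk⟩ := pow_unbounded_of_one_lt y hb
  obtain ⟨m, hm⟩ := pow_unbounded_of_one_lt y⁻¹ hb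
  -- The range is an interval containing arbitrarily large powers of `r b > 1` and their inverses.
  refine hord.out ⟨(b ^ m)⁻¹, rfl⟩ ⟨b ^ k, rfl⟩ ⟨?_, by rw [map_pow]; exact hk.le⟩
  rw [hinv, map_pow]
  exact inv_le_of_inv_le₀ hy hm.le

/-! ### The real and complex cases -/

section Main

open Filter Topology

variable {n : ℕ} {E : Type*} [NormedAddCommGroup E] [NormedSpace ℝ E]
  {G : Type*} [Group G] [TopologicalSpace G] [ChartedSpace E G]
  {ι : G →* RealGL n}

/-- The restriction of a linear group with values in a subalgebra to a homomorphism with values in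
an isomorphic algebra. -/
def subalgebraHom {F : Type*} [Ring F] [Algebra ℝ F] {K : Subalgebra ℝ (RealEnd n)}
    (σ : K ≃ₐ[ℝ] F) (ι : G →* RealGL n) (P : Subgroup G) (hP : ∀ z ∈ P, (ι z : RealEnd n) ∈ K) :
    P →* F where
  toFun p := σ ⟨ι p, hP p p.2⟩
  map_one' := by
    rw [← map_one σ]
    exact congrArg σ (Subtype.ext (by simp))
  map_mul' p q := by
    rw [← map_mul]
    exact congrArg σ (Subtype.ext (by simp))

/-- Extending `σ` linearly to all endomorphisms makes `σ ∘ ι` the restriction of a map defined on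
all of `G`, with the regularity of `ι`. -/
lemma exists_extend_algEquiv {F : Type*} [NormedRing F] [NormedAlgebra ℝ F]
    {K : Subalgebra ℝ (RealEnd n)} (σ : K ≃ₐ[ℝ] F) :
    ∃ ψ : RealEnd n →L[ℝ] F, ∀ x : K, ψ x = σ x := by
  obtain ⟨ψ, hψ⟩ := (σ.toLinearMap : K →ₗ[ℝ] F).exists_extend (p := Subalgebra.toSubmodule K)
  exact ⟨LinearMap.toContinuousLinearMap ψ, fun x => LinearMap.congr_fun hψ x⟩

lemma image_eq_of_algEquiv_real (hι : Continuous ι) (hinj : Function.Injective ι)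
    {K : Subalgebra ℝ (RealEnd n)} (σ : K ≃ₐ[ℝ] ℝ) {P : Subgroup G} [ConnectedSpace P]
    (hP : ∀ z ∈ P, (ι z : RealEnd n) ∈ K) (hne : P ≠ ⊥) :
    ((P.map ι : Set (RealGL n)) = {g | ∃ r : ℝ, 0 < r ∧ ((g : RealGL n) : RealEnd n) = r • 1}) := by
  let r : P →* ℝ := subalgebraHom σ ι P hP
  have hr : Continuous r := by
    obtain ⟨ψ, hψ⟩ := exists_extend_algEquiv σ
    exact (ψ.continuous.comp (Units.continuous_val.comp (hι.comp continuous_subtype_val))).congr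
      fun p => hψ ⟨ι p, hP p p.2⟩
  have hιr : ∀ p : P, (ι p : RealEnd n) = r p • 1 := fun p => by
    have h1 : σ ⟨ι p, hP p p.2⟩ = σ (algebraMap ℝ K (r p)) := (σ.commutes (r p)).symm
    exact (congrArg Subtype.val (σ.injective h1)).trans (Algebra.algebraMap_eq_smul_one (r p))
  obtain ⟨a, ha⟩ := Subgroup.ne_bot_iff_exists_ne_one.1 hne
  have ha1 : r a ≠ 1 := fun h =>
    ha (Subtype.ext (hinj (Units.ext (by rw [hιr, h]; simp))))
  have hrange := range_eq_Ioi_of_connected r hr ha1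
  ext g
  constructor
  · rintro ⟨p, hp, rfl⟩
    have : r ⟨p, hp⟩ ∈ Set.Ioi 0 := hrange ▸ Set.mem_range_self _
    exact ⟨r ⟨p, hp⟩, this, hιr ⟨p, hp⟩⟩
  · rintro ⟨t, ht, hg⟩
    obtain ⟨p, rfl⟩ := hrange.symm ▸ (Set.mem_Ioi.2 ht)
    exact ⟨p, p.2, Units.ext ((hιr p).trans hg.symm)⟩

lemma smoothOnSubset_of_continuousLinearMap
    (hι : ContMDiff 𝓘(ℝ, E) 𝓘(ℝ, RealEnd n) ∞ ι) {P : Subgroup G}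
    (ψ : RealEnd n →L[ℝ] ℂ) {j : P →* ℂˣ} (hψ : ∀ p : P, (j p : ℂ) = ψ (ι p : RealEnd n)) :
    SmoothOnSubset (E := E) (F := ℂ) (P : Set G) j := by
  classical
  have hs : ContMDiff 𝓘(ℝ, E) 𝓘(ℝ, ℂ) ∞ fun g : G => ψ (ι g : RealEnd n) :=
    ψ.contDiff.contMDiff.comp (Units.contMDiff_val.comp hι)
  let φ : G → ℂˣ := fun g => if h : ψ (ι g : RealEnd n) ≠ 0 then Units.mk0 _ h else 1
  have hφ : ∀ g, ψ (ι g : RealEnd n) ≠ 0 → (φ g : ℂ) = ψ (ι g : RealEnd n) := fun g hg => by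
    simp only [φ, dif_pos hg, Units.val_mk0]
  refine fun p => ⟨{g | ψ (ι g : RealEnd n) ≠ 0}, isOpen_ne_fun hs.continuous continuous_const,
    fun h => (j p).ne_zero ((hψ p).trans h), φ, ?_, fun q hq => Units.ext ((hφ q hq).trans (hψ q).symm)⟩
  have h1 : ContMDiffOn 𝓘(ℝ, E) 𝓘(ℝ, ℂ) ∞ (fun g => (φ g : ℂ))
      {g | ψ (ι g : RealEnd n) ≠ 0} := hs.contMDiffOn.congr hφ
  have h2 : ContMDiffOn 𝓘(ℝ, ℂ) 𝓘(ℝ, ℂ) ∞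
      (Units.isOpenEmbedding_val.toOpenPartialHomeomorph (Units.val : ℂˣ → ℂ)).symm
      (Set.range (Units.val : ℂˣ → ℂ)) :=
    contMDiffOn_isOpenEmbedding_symm Units.isOpenEmbedding_val
  refine (h2.comp h1 fun g _ => ⟨φ g, rfl⟩).congr fun g _ => ?_
  exact (Topology.IsOpenEmbedding.toOpenPartialHomeomorph_left_inv Units.val
    Units.isOpenEmbedding_val).symm

/-- The inverse of `σ` induces a smooth `θ : ℂˣ → GL(n, ℝ)` with `θ ∘ j = ι` on `P`, which reduces
smoothness of the inverse of `j` to the immersion `ι`. -/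
lemma lieIsomorphic_of_algEquiv_complex [LieGroup 𝓘(ℝ, E) ∞ G]
    (hinj : Function.Injective ι) (himm : Manifold.IsImmersion 𝓘(ℝ, E) 𝓘(ℝ, RealEnd n) ∞ ι)
    {K : Subalgebra ℝ (RealEnd n)} (σ : K ≃ₐ[ℝ] ℂ) {P : Subgroup G} [ConnectedSpace P]
    [LocallyCompactSpace P] (hP : ∀ z ∈ P, (ι z : RealEnd n) ∈ K) :
    LieIsomorphic (E := E) (F := ℂ) P (⊤ : Subgroup ℂˣ) ∨
      ∃ Q : Subgroup ℂˣ, IsOneParameterSubgroup (E := ℂ) Q ∧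
        LieIsomorphic (E := E) (F := ℂ) P Q := by
  have : IsTopologicalGroup G := topologicalGroup_of_lieGroup 𝓘(ℝ, E) ∞
  let j : P →* ℂˣ := (subalgebraHom σ ι P hP).toHomUnits
  obtain ⟨Ψ, hσ⟩ := exists_extend_algEquiv σ
  have hΨ : ∀ p : P, (j p : ℂ) = Ψ (ι p : RealEnd n) := fun p => (hσ ⟨ι p, hP p p.2⟩).symm
  have hj : Continuous j := by
    rw [Units.isEmbedding_val₀.continuous_iff]
    have h1 : Continuous fun p : P => Ψ (ι p : RealEnd n) :=
      Ψ.continuous.comp (Units.continuous_val.comp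
        (himm.contMDiff.continuous.comp continuous_subtype_val))
    exact h1.congr fun p => (hΨ p).symm
  have hjinj : Function.Injective j := fun p q hpq => by
    have h1 : σ ⟨ι p, hP p p.2⟩ = σ ⟨ι q, hP q q.2⟩ := congrArg Units.val hpq
    exact Subtype.ext (hinj (Units.ext (congrArg Subtype.val (σ.injective h1))))
  let θ : ℂˣ →* RealGL n := Units.map (K.val.comp σ.symm.toAlgHom : ℂ →* RealEnd n)
  have hθ : ContMDiff 𝓘(ℝ, ℂ) 𝓘(ℝ, RealEnd n) ∞ θ := by
    apply ContMDiff.of_comp_isOpenEmbedding Units.isOpenEmbedding_val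
    let Θ : ℂ →L[ℝ] RealEnd n :=
      LinearMap.toContinuousLinearMap (K.val.comp σ.symm.toAlgHom).toLinearMap
    exact Θ.contDiff.contMDiff.comp Units.contMDiff_val
  have hcomp : ∀ p : P, θ (j p) = ι p := fun p => Units.ext
    (congrArg Subtype.val (σ.symm_apply_apply ⟨ι p, hP p p.2⟩))
  have hiso : LieIsomorphic (E := E) (F := ℂ) P j.range := by
    refine lieIsomorphic_range ι (himm.isImmersionAt 1) θ hθ P j hjinj
      (smoothOnSubset_of_continuousLinearMap himm.contMDiff Ψ hΨ) (fun W hW => ?_) hcomp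
    obtain ⟨V, hV, hVW⟩ := exists_nhds_one_of_map_mem hj hjinj
      (continuous_subtype_val.continuousAt.preimage_mem_nhds hW : ((↑) : P → G) ⁻¹' W ∈ 𝓝 1)
    exact ⟨Units.val ⁻¹' V, Units.continuous_val.continuousAt.preimage_mem_nhds hV, hVW⟩
  rcases range_eq_top_or_isOneParameterSubgroup hj hjinj with h | h
  · exact Or.inl (h ▸ hiso)
  · exact Or.inr ⟨_, h, hiso⟩

end Main

theorem proposition3 (n : ℕ)
    (E : Type*) [NormedAddCommGroup E] [NormedSpace ℝ E] [FiniteDimensional ℝ E]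
    (G : Type*) [Group G] [TopologicalSpace G] [ChartedSpace E G] [LieGroup 𝓘(ℝ, E) ∞ G]
    [ConnectedSpace G]
    (ι : G →* RealGL n) (hinj : Function.Injective ι)
    (himm : Manifold.IsImmersion 𝓘(ℝ, E) 𝓘(ℝ, RealEnd n) ∞ ι)
    (hirr : (linearAction ι).IsIrreducible)
    (hZ : centerIdentityComponent E G ≠ ⊥) :
    (((centerIdentityComponent E G).map ι : Set (RealGL n)) =
        {g | ∃ r : ℝ, 0 < r ∧ ((g : RealGL n) : RealEnd n) = r • 1}) ∨
    (Even n ∧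
      (LieIsomorphic (E := E) (F := ℂ) (centerIdentityComponent E G) (⊤ : Subgroup ℂˣ) ∨
        ∃ P : Subgroup ℂˣ, IsOneParameterSubgroup (E := ℂ) P ∧
          LieIsomorphic (E := E) (F := ℂ) (centerIdentityComponent E G) P)) := by
  have hι : Continuous ι := himm.contMDiff.continuous
  -- Hausdorffness is inherited from `GL(n, ℝ)` through the continuous injection `ι`.
  have : T2Space G := T2Space.of_injective_continuous hinj hι
  have := locallyCompactSpace_centerIdentityComponent (E := E) (G := G)
  obtain ⟨K, hK, ⟨⟨σ⟩⟩ | ⟨⟨σ⟩⟩⟩ := exists_subalgebra_center hirr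
  · exact Or.inl (image_eq_of_algEquiv_real hι hinj σ
      (fun z hz => hK z (centerIdentityComponent_le_center hz)) hZ)
  · exact Or.inr ⟨even_of_subalgebra_algEquiv_complex σ, lieIsomorphic_of_algEquiv_complex hinj himm σ
      fun z hz => hK z (centerIdentityComponent_le_center hz)⟩
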